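/- A polygonal chain $P=(p_1,\dots,p_n)$ in the Euclidean plane consists of the $n-1$ segments between consecutive vertices. It is simple if consecutive segments meet only in their common endpoint and non-consecutive segments are disjoint; it is a $c$-chain if $|p_ip_j|+|p_jp_k|\le c\,|p_ip_k|$ for all $1\le i<j<k\le n$; its stretch factor is $\delta_P=\sum_{i=1}^{n-1}|p_ip_{i+1}|/|p_1p_n|$. Logarithms are in base $2$. For $c\ge 4$ put $c_*=\frac{c-2}{2}$ and $a=\frac{c_*}{2(c_*+1)}$. Let $P^0_c=((0,0),(1,0))$, and let $P^{k+1}_c$ arise from $P^k_c$ by replacing every segment $pq$, in order, by the image under the orientation-preserving similarity mapping $(0,0)\mapsto p$, $(1,0)\mapsto q$ of the chain $$(0,0),\quad \Bigl(\tfrac12-\tfrac{a}{c_*},0\Bigr),\quad \Bigl(\tfrac12,\tfrac{a\sqrt{c_*^2-1}}{c_*}\Bigr),\quad \Bigl(\tfrac12+\tfrac{a}{c_*},0\Bigr),\quad (1,0).$$ Theorem. (i) For every real $c\ge 4$ and every integer $k\ge 0$, the chain $P^k_c$ has $n=4^k+1$ (distinct) vertices, is simple, is a $c$-chain, and has stretch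 factor exactly $$\delta_{P^k_c}=(n-1)^{\frac{1+\log(c-2)-\log c}{2}}.$$ (ii) $\lim_{c\to\infty}\frac{1+\log(c-2)-\log c}{2}=\frac12$. (iii) Consequently, for every $\varepsilon>0$ there are $c_0\ge 4$ and $\kappa>0$ such that for all $c\ge c_0$ and all $k\ge 0$ the chain $P^k_c$ with $n=4^k+1$ vertices satisfies $\delta_{P^k_c}\ge \kappa\, n^{1/2-\varepsilon}$. -/

import Mathlib

/-- A polygonal chain with `m` segments in the Euclidean plane: the sequence of its `m + 1` vertices.
The plane is modelled by `ℂ`, whose distance is the Euclidean one. -/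
abbrev PolygonalChain (m : ℕ) : Type := Fin (m + 1) → ℂ

namespace PolygonalChain

variable {m : ℕ}

/-- The `i`-th closed line segment of the chain, joining vertex `i` to vertex `i + 1`. -/
def seg (P : PolygonalChain m) (i : Fin m) : Set ℂ :=
  segment ℝ (P i.castSucc) (P i.succ)

/-- A chain is simple if only consecutive segments intersect, and these meet only in their
common endpoint. -/
def IsSimple (P : PolygonalChain m) : Prop :=
  ∀ i j : Fin m, i < j →
    ((j : ℕ) = i + 1 → P.seg i ∩ P.seg j = {P j.castSucc}) ∧
    ((j : ℕ) ≠ i + 1 → P.seg i ∩ P.seg j = ∅)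

/-- The `c`-chain condition, on all triples of vertices taken in the order of the chain. -/
def IsCChain (c : ℝ) (P : PolygonalChain m) : Prop :=
  ∀ i j k : Fin (m + 1), i < j → j < k →
    dist (P i) (P j) + dist (P j) (P k) ≤ c * dist (P i) (P k)

/-- Total length of the chain divided by the distance of its two endpoints. -/
noncomputable def stretchFactor (P : PolygonalChain m) : ℝ :=
  (∑ i : Fin m, dist (P i.castSucc) (P i.succ)) / dist (P 0) (P (Fin.last m))

end PolygonalChain

/-- The parameter `c_* = (c - 2) / 2`. -/
noncomputable def cStar (c : ℝ) : ℝ := (c - 2) / 2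

/-- The relative side length `a = c_* / (2 (c_* + 1))` of the isosceles triangle. -/
noncomputable def sideLength (c : ℝ) : ℝ := cStar c / (2 * (cStar c + 1))

/-- The first four vertices of the chain that replaces the unit segment from `0` to `1` (its fifth
vertex is `1`): the segment is cut at `1/2 - a/c_*` and `1/2 + a/c_*`, and the middle piece is
replaced by the two sides of length `a` of the isosceles triangle erected over it on the left. -/
noncomputable def pattern (c : ℝ) : Fin 4 → ℂ :=
  ![0,
    ⟨1 / 2 - sideLength c / cStar c, 0⟩,
    ⟨1 / 2, sideLength c * √(cStar c ^ 2 - 1) / cStar c⟩,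
    ⟨1 / 2 + sideLength c / cStar c, 0⟩]

/-- The vertices of the iterated construction. Generation `0` is `0, 1` (continued for convenience
by `2, 3, …`); generation `k + 1` arises by replacing the segment from vertex `j` to vertex `j + 1`
of generation `k` by the image of the pattern under the orientation-preserving similarity that maps
`0` and `1` to these two vertices, which produces the vertices `4 j, …, 4 j + 4`. Only the indices
`0, …, 4 ^ k` matter in generation `k`. -/
noncomputable def cesaroVertex (c : ℝ) : ℕ → ℕ → ℂ
  | 0, i => (i : ℂ)
  | k + 1, i =>
      cesaroVertex c k (i / 4) +
        pattern c (Fin.ofNat 4 i) * (cesaroVertex c k (i / 4 + 1) - cesaroVertex c k (i / 4))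

/-- The `k`-th chain of the family: it has `4 ^ k` segments and `4 ^ k + 1` vertices. -/
noncomputable def cesaroChain (c : ℝ) (k : ℕ) : PolygonalChain (4 ^ k) :=
  fun i => cesaroVertex c k i

/-- The exponent `(1 + log (c - 2) - log c) / 2`, with logarithms in base 2. -/
noncomputable def stretchExponent (c : ℝ) : ℝ :=
  (1 + Real.logb 2 (c - 2) - Real.logb 2 c) / 2

namespace Cesaro

/-! Put τ = √(1 - 4/c), so c(1 - τ²) = 4, and θ = arctan τ. All four edges of the pattern have
length (1 + τ²)/4, and the middle two make angles 2θ and -2θ with the base. Although each generation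
refines single edges, generation k + 1 also consists of four images of generation k under `sim τ j`
(`vertex_succ`). These similarities map the triangle with base [0, 1] and base angles θ into itself
(`sim_mem`), so it contains every generation, and the geometric claims become inductions on k about
four small triangles.

Two of these are separated horizontally (`dist_sim_gap`) or share a vertex v. In the second case,
for p and q in the earlier and later copy, v - p and q - v lie within 2θ of one fixed direction.
Since cos 2θ = (1 - τ²)/(1 + τ²), projection bounds |pv| + |vq| by |pq| / cos 2θ
(`dist_sim_adjacent`). Hence the copies meet only in v, which gives simplicity.

For the c-chain property with p, q in adjacent copies and the middle vertex r in that of p,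
`dist_le_dist_last` gives |pr| ≤ |pv|, so |pr| + |rq| ≤ 2|pr| + |pq| ≤ c|pq|; the other case is the
mirror image. Non-adjacent copies are settled by the gaps (`dist_add_dist_gap`). The stretch factor
counts 4^k edges of length ((1 + τ²)/4)^k over a base of length 1. -/

/-- The starting points of the four segments of the pattern with base slope `τ`. -/
noncomputable def base (τ : ℝ) : Fin 4 → ℂ :=
  ![0, ⟨(1 + τ ^ 2) / 4, 0⟩, ⟨1 / 2, τ / 2⟩, ⟨(3 - τ ^ 2) / 4, 0⟩]

/-- The direction vectors of the four segments of the pattern with base slope `τ`. -/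
noncomputable def dir (τ : ℝ) : Fin 4 → ℂ :=
  ![⟨(1 + τ ^ 2) / 4, 0⟩, ⟨(1 - τ ^ 2) / 4, τ / 2⟩, ⟨(1 - τ ^ 2) / 4, -τ / 2⟩,
    ⟨(1 + τ ^ 2) / 4, 0⟩]

/-- The similarity mapping `0` and `1` to the endpoints of the `j`-th segment of the pattern. -/
noncomputable def sim (τ : ℝ) (j : Fin 4) (z : ℂ) : ℂ := base τ j + dir τ j * z

/-- The closed triangle with base `[0, 1]` and apex `1/2 + (τ/2) i`. -/
def triangle (τ : ℝ) : Set ℂ :=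
  {z | 0 ≤ z.re ∧ z.re ≤ 1 ∧ 0 ≤ z.im ∧ z.im ≤ τ * z.re ∧ z.im ≤ τ * (1 - z.re)}

/-- The reflection in the perpendicular bisector of the segment from `0` to `1`. -/
noncomputable def mirror (z : ℂ) : ℂ := ⟨1 - z.re, z.im⟩

/-- The slope of the sides of the triangle spanned by the pattern with parameter `c`. -/
noncomputable def slope (c : ℝ) : ℝ := √(1 - 4 / c)

variable {τ c : ℝ}

/-! ### Similarities, mirror symmetry and the triangle. -/

@[simp] lemma base_zero : base τ 0 = 0 := rfl
@[simp] lemma base_one : base τ 1 = ⟨(1 + τ ^ 2) / 4, 0⟩ := rfl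
@[simp] lemma base_two : base τ 2 = ⟨1 / 2, τ / 2⟩ := rfl
@[simp] lemma base_three : base τ 3 = ⟨(3 - τ ^ 2) / 4, 0⟩ := rfl
@[simp] lemma dir_zero : dir τ 0 = ⟨(1 + τ ^ 2) / 4, 0⟩ := rfl
@[simp] lemma dir_one : dir τ 1 = ⟨(1 - τ ^ 2) / 4, τ / 2⟩ := rfl
@[simp] lemma dir_two : dir τ 2 = ⟨(1 - τ ^ 2) / 4, -τ / 2⟩ := rfl
@[simp] lemma dir_three : dir τ 3 = ⟨(1 + τ ^ 2) / 4, 0⟩ := rfl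

lemma norm_le_of_sq_le {z : ℂ} {r : ℝ} (hr : 0 ≤ r) (h : z.re ^ 2 + z.im ^ 2 ≤ r ^ 2) :
    ‖z‖ ≤ r := by
  rw [Complex.norm_eq_sqrt_sq_add_sq]
  exact Real.sqrt_le_iff.2 ⟨hr, h⟩

lemma dist_le_dist_of_sq_le {p q r s : ℂ}
    (h : (p.re - q.re) ^ 2 + (p.im - q.im) ^ 2 ≤ (r.re - s.re) ^ 2 + (r.im - s.im) ^ 2) :
    dist p q ≤ dist r s := by
  rw [Complex.dist_eq_re_im, Complex.dist_eq_re_im]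
  exact Real.sqrt_le_sqrt h

lemma norm_dir (j : Fin 4) : ‖dir τ j‖ = (1 + τ ^ 2) / 4 := by
  rw [Complex.norm_eq_sqrt_sq_add_sq, Real.sqrt_eq_iff_mul_self_eq (by positivity) (by positivity)]
  fin_cases j <;> simp <;> ring

lemma dist_sim (j : Fin 4) (z w : ℂ) :
    dist (sim τ j z) (sim τ j w) = (1 + τ ^ 2) / 4 * dist z w := by
  rw [sim, sim, dist_add_left, dist_eq_norm, dist_eq_norm, ← mul_sub, norm_mul, norm_dir]

lemma sim_injective (j : Fin 4) : Function.Injective (sim τ j) := by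
  intro z w h
  have := dist_sim (τ := τ) j z w
  rw [h, dist_self] at this
  have h4 : 0 < (1 + τ ^ 2) / 4 := by positivity
  exact dist_eq_zero.1 ((mul_eq_zero.1 this.symm).resolve_left h4.ne')

lemma sim_one_eq {j l : Fin 4} (h : (l : ℕ) = j + 1) : sim τ j 1 = sim τ l 0 := by
  fin_cases j <;> fin_cases l <;> simp at h <;>
    apply Complex.ext <;> simp [sim] <;> ring

lemma sim_zero_zero : sim τ 0 0 = 0 := by simp [sim]

lemma sim_three_one : sim τ 3 1 = 1 := by
  apply Complex.ext <;> simp [sim]; ring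

lemma mirror_mirror (z : ℂ) : mirror (mirror z) = z := by
  apply Complex.ext <;> simp [mirror]

lemma mirror_zero : mirror 0 = 1 := by apply Complex.ext <;> simp [mirror]

lemma mirror_one : mirror 1 = 0 := by apply Complex.ext <;> simp [mirror]

lemma dist_mirror (z w : ℂ) : dist (mirror z) (mirror w) = dist z w := by
  rw [Complex.dist_eq_re_im, Complex.dist_eq_re_im]
  simp only [mirror]
  congr 1
  ring

lemma mirror_mem {z : ℂ} (hz : z ∈ triangle τ) : mirror z ∈ triangle τ := by
  obtain ⟨h1, h2, h3, h4, h5⟩ := hz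
  refine ⟨?_, ?_, ?_, ?_, ?_⟩ <;> simp [mirror] <;> linarith

lemma mirror_sim (j : Fin 4) (z : ℂ) : mirror (sim τ j z) = sim τ j.rev (mirror z) := by
  fin_cases j <;> apply Complex.ext <;>
    simp [mirror, sim, Fin.rev] <;> ring

lemma zero_mem (h : 0 ≤ τ) : (0 : ℂ) ∈ triangle τ := by simp [triangle, h]

lemma one_mem (h : 0 ≤ τ) : (1 : ℂ) ∈ triangle τ := by simp [triangle, h]

lemma convex_triangle : Convex ℝ (triangle τ) := by
  rintro z ⟨h1, h2, h3, h4, h5⟩ w ⟨k1, k2, k3, k4, k5⟩ a b ha hb hab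
  obtain rfl : a = 1 - b := by linarith
  refine ⟨?_, ?_, ?_, ?_, ?_⟩ <;> simp <;> nlinarith

/-- A convex set that contains the three corners of the triangle contains the triangle. -/
lemma triangle_subset_of_convex (hτ : 0 ≤ τ) {K : Set ℂ} (hK : Convex ℝ K) (h0 : (0 : ℂ) ∈ K)
    (h2 : (⟨1 / 2, τ / 2⟩ : ℂ) ∈ K) (h1 : (1 : ℂ) ∈ K) : triangle τ ⊆ K := by
  rintro z ⟨z1, z2, z3, z4, z5⟩
  -- Here s is half the barycentric weight of the apex; for τ = 0 the triangle is flat and s = 0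
  -- serves.
  obtain ⟨s, hs0, hs⟩ : ∃ s : ℝ, 0 ≤ s ∧ z.im = s * τ ∧ s ≤ z.re ∧ s ≤ 1 - z.re := by
    rcases hτ.eq_or_lt with rfl | hpos
    · exact ⟨0, le_rfl, by linarith, by linarith, by linarith⟩
    · refine ⟨z.im / τ, by positivity, by field_simp, ?_, ?_⟩ <;> rw [div_le_iff₀ hpos] <;> linarith
  obtain ⟨hs1, hs2, hs3⟩ := hs
  have key := hK.sum_mem (t := Finset.univ) (w := ![1 - z.re - s, 2 * s, z.re - s])
    (z := ![0, ⟨1 / 2, τ / 2⟩, 1]) (by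
      intro i _; fin_cases i <;> simp <;> linarith) (by simp [Fin.sum_univ_three]; ring) (by
      intro i _; fin_cases i <;> simp <;> first | assumption | simpa using h2)
  convert key using 1
  simp only [Fin.sum_univ_three]
  apply Complex.ext <;> simp
  · ring
  · rw [hs1]; ring

lemma convex_preimage_sim {K : Set ℂ} (hK : Convex ℝ K) (j : Fin 4) :
    Convex ℝ (sim τ j ⁻¹' K) := by
  intro x hx y hy a b ha hb hab
  rw [Set.mem_preimage]
  convert hK hx hy ha hb hab using 1
  have hab' : (a : ℂ) + b = 1 := by exact_mod_cast hab
  simp only [sim, Complex.real_smul]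
  linear_combination (-base τ j) * hab'

lemma sim_mem (h0 : 0 ≤ τ) (h1 : τ < 1) (j : Fin 4) {z : ℂ} (hz : z ∈ triangle τ) :
    sim τ j z ∈ triangle τ := by
  have hq : τ ^ 2 < 1 := by nlinarith
  have key : ∀ j : Fin 4, sim τ j 0 ∈ triangle τ ∧ sim τ j ⟨1 / 2, τ / 2⟩ ∈ triangle τ ∧
      sim τ j 1 ∈ triangle τ := by
    intro j
    fin_cases j <;> simp [sim, triangle] <;> (repeat' constructor) <;> try nlinarith
  exact triangle_subset_of_convex h0 (convex_preimage_sim convex_triangle j) (key j).1 (key j).2.1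
    (key j).2.2 hz

/-- For τ < 1 the triangle lies in the disc with diameter [0, 1]; since balls are convex, only
distances to the corners matter. -/
lemma dist_le_one (h0 : 0 ≤ τ) (h1 : τ < 1) {z w : ℂ} (hz : z ∈ triangle τ)
    (hw : w ∈ triangle τ) : dist z w ≤ 1 := by
  obtain ⟨a1, a2, a3, a4, a5⟩ := hz
  have key : triangle τ ⊆ Metric.closedBall z 1 := by
    have hy : z.im ^ 2 ≤ z.re * (1 - z.re) := by
      calc z.im ^ 2 = z.im * z.im := sq _
        _ ≤ (τ * z.re) * (τ * (1 - z.re)) := by gcongr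
        _ = τ ^ 2 * (z.re * (1 - z.re)) := by ring
        _ ≤ 1 * (z.re * (1 - z.re)) := by
          gcongr
          nlinarith
        _ = _ := one_mul _
    refine triangle_subset_of_convex h0 (convex_closedBall z 1) ?_ ?_ ?_ <;>
      rw [Metric.mem_closedBall, dist_eq_norm] <;>
      refine norm_le_of_sq_le zero_le_one ?_ <;> simp <;> nlinarith
  rw [dist_comm]
  exact Metric.mem_closedBall.1 (key hw)

/-! ### Cone estimates for adjacent copies. -/

/-- The direction of a nonzero point of the triangle makes with `(1 - τ ^ 2, 2 * τ)` an angle whose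
cosine is at least `(1 - τ ^ 2) / (1 + τ ^ 2)`. -/
lemma norm_le_cone (h0 : 0 ≤ τ) (h1 : τ < 1) {z : ℂ} (hz : z ∈ triangle τ) :
    (1 - τ ^ 2) * ‖z‖ ≤ (1 - τ ^ 2) * z.re + 2 * τ * z.im := by
  obtain ⟨a1, a2, a3, a4, a5⟩ := hz
  have hq : 0 < 1 - τ ^ 2 := by nlinarith
  rw [← le_div_iff₀' hq]
  apply norm_le_of_sq_le (by positivity)
  rw [div_pow, le_div_iff₀ (by positivity)]
  have e1 : z.im ^ 2 ≤ τ * z.re * z.im := by nlinarith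
  nlinarith [mul_le_mul_of_nonneg_left e1 hq.le, sq_nonneg τ, sq_nonneg z.im,
    mul_nonneg (sq_nonneg τ) (sq_nonneg z.im), mul_nonneg hq.le (sq_nonneg z.im)]

/-- The direction of a nonzero point of the triangle makes with `(1, -τ)` an angle whose cosine is
at least `(1 - τ ^ 2) / (1 + τ ^ 2)`. -/
lemma norm_le_cone_steep (h0 : 0 ≤ τ) (h1 : τ < 1) {z : ℂ} (hz : z ∈ triangle τ) :
    (1 - τ ^ 2) * ‖z‖ ≤ √(1 + τ ^ 2) * (z.re - τ * z.im) := by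
  obtain ⟨a1, a2, a3, a4, a5⟩ := hz
  have hq : 0 < 1 - τ ^ 2 := by nlinarith
  have hx : (1 - τ ^ 2) * z.re ≤ z.re - τ * z.im := by nlinarith
  have hn : ‖z‖ ≤ √(1 + τ ^ 2) * z.re := by
    apply norm_le_of_sq_le (by positivity)
    rw [mul_pow, Real.sq_sqrt (by positivity)]
    nlinarith
  calc (1 - τ ^ 2) * ‖z‖ ≤ (1 - τ ^ 2) * (√(1 + τ ^ 2) * z.re) := by gcongr
    _ = √(1 + τ ^ 2) * ((1 - τ ^ 2) * z.re) := by ring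
    _ ≤ _ := by gcongr

lemma re_add_mul_im_le (z : ℂ) : z.re + τ * z.im ≤ √(1 + τ ^ 2) * ‖z‖ := by
  rw [Complex.norm_eq_sqrt_sq_add_sq, ← Real.sqrt_mul (by positivity)]
  apply Real.le_sqrt_of_sq_le
  nlinarith [sq_nonneg (τ * z.re - z.im)]

lemma norm_one_sub (z : ℂ) : ‖1 - z‖ = ‖mirror z‖ := by
  rw [Complex.norm_eq_sqrt_sq_add_sq, Complex.norm_eq_sqrt_sq_add_sq]
  simp [mirror]

lemma dist_sim_one (j : Fin 4) (z : ℂ) :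
    dist (sim τ j z) (sim τ j 1) = (1 + τ ^ 2) / 4 * ‖mirror z‖ := by
  rw [dist_sim, dist_comm, dist_eq_norm, norm_one_sub]

lemma dist_zero_sim (j : Fin 4) (z : ℂ) :
    dist (sim τ j 0) (sim τ j z) = (1 + τ ^ 2) / 4 * ‖z‖ := by
  rw [dist_sim, dist_zero_left]

/-- Vectors into the common vertex have angles in [-θ, 0], vectors out of it in [2θ, 3θ]. All are
within 2θ of (1, τ), which has angle θ. -/
lemma dist_sim_zero_one (h0 : 0 ≤ τ) (h1 : τ < 1) {z w : ℂ} (hz : z ∈ triangle τ)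
    (hw : w ∈ triangle τ) :
    (1 - τ ^ 2) * (dist (sim τ 0 z) (sim τ 0 1) + dist (sim τ 1 0) (sim τ 1 w)) ≤
      (1 + τ ^ 2) * dist (sim τ 0 z) (sim τ 1 w) := by
  rw [dist_sim_one, dist_zero_sim, dist_comm, dist_eq_norm]
  have c1 := norm_le_cone_steep h0 h1 (mirror_mem hz)
  have c2 := norm_le_cone_steep h0 h1 hw
  have c3 := re_add_mul_im_le (τ := τ) (sim τ 1 w - sim τ 0 z)
  have e : (sim τ 1 w - sim τ 0 z).re + τ * (sim τ 1 w - sim τ 0 z).im =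
      (1 + τ ^ 2) / 4 * (((mirror z).re - τ * (mirror z).im) + (w.re - τ * w.im)) := by
    simp [sim, mirror]; ring
  rw [e] at c3
  have hR : √(1 + τ ^ 2) * √(1 + τ ^ 2) = 1 + τ ^ 2 := Real.mul_self_sqrt (by positivity)
  have c4 := mul_le_mul_of_nonneg_left c3 (Real.sqrt_nonneg (1 + τ ^ 2))
  rw [← mul_assoc √(1 + τ ^ 2) √(1 + τ ^ 2), hR] at c4
  refine le_trans ?_ c4
  have ha : 0 ≤ (1 + τ ^ 2) / 4 := by positivity
  have := mul_le_mul_of_nonneg_left (add_le_add c1 c2) ha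
  linarith

/-- At the apex the angles lie in [θ, 2θ] and [-2θ, -θ], so the horizontal direction serves. -/
lemma dist_sim_one_two (h0 : 0 ≤ τ) (h1 : τ < 1) {z w : ℂ} (hz : z ∈ triangle τ)
    (hw : w ∈ triangle τ) :
    (1 - τ ^ 2) * (dist (sim τ 1 z) (sim τ 1 1) + dist (sim τ 2 0) (sim τ 2 w)) ≤
      (1 + τ ^ 2) * dist (sim τ 1 z) (sim τ 2 w) := by
  rw [dist_sim_one, dist_zero_sim, dist_comm (sim τ 1 z), dist_eq_norm]
  have c1 := norm_le_cone h0 h1 (mirror_mem hz)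
  have c2 := norm_le_cone h0 h1 hw
  have c3 := Complex.re_le_norm (sim τ 2 w - sim τ 1 z)
  have e : (sim τ 2 w - sim τ 1 z).re =
      (((1 - τ ^ 2) * (mirror z).re + 2 * τ * (mirror z).im) +
        ((1 - τ ^ 2) * w.re + 2 * τ * w.im)) / 4 := by
    simp [sim, mirror]; ring
  rw [e] at c3
  have ha : 0 ≤ 1 + τ ^ 2 := by positivity
  have := mul_le_mul_of_nonneg_left c3 ha
  have := mul_le_mul_of_nonneg_left (add_le_add c1 c2) ha
  linarith

/-- Points of two adjacent copies are at a distance comparable to their distances from the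
common vertex. -/
lemma dist_sim_adjacent (h0 : 0 ≤ τ) (h1 : τ < 1) {j l : Fin 4} (hjl : (l : ℕ) = j + 1) {z w : ℂ}
    (hz : z ∈ triangle τ) (hw : w ∈ triangle τ) :
    (1 - τ ^ 2) * (dist (sim τ j z) (sim τ j 1) + dist (sim τ l 0) (sim τ l w)) ≤
      (1 + τ ^ 2) * dist (sim τ j z) (sim τ l w) := by
  have key := dist_sim_zero_one h0 h1 (mirror_mem hw) (mirror_mem hz)
  obtain ⟨rfl, rfl⟩ | ⟨rfl, rfl⟩ | ⟨rfl, rfl⟩ :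
      (j = 0 ∧ l = 1) ∨ (j = 1 ∧ l = 2) ∨ (j = 2 ∧ l = 3) := by
    fin_cases j <;> fin_cases l <;> simp at hjl ⊢
  · exact dist_sim_zero_one h0 h1 hz hw
  · exact dist_sim_one_two h0 h1 hz hw
  · rw [← dist_mirror (sim τ 2 z) (sim τ 3 w), mirror_sim, mirror_sim]
    change _ ≤ (1 + τ ^ 2) * dist (sim τ 1 (mirror z)) (sim τ 0 (mirror w))
    rw [dist_comm (sim τ 1 (mirror z))]
    refine le_trans (le_of_eq ?_) key
    rw [dist_sim_one, dist_zero_sim, dist_sim_one, dist_zero_sim, mirror_mirror]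
    ring

/-! ### Copies without a common vertex. -/

/-- Points of two copies that are not adjacent are separated horizontally. -/
lemma dist_sim_gap (h0 : 0 ≤ τ) (h1 : τ < 1) {j l : Fin 4} (hjl : (j : ℕ) + 1 < l) {z w : ℂ}
    (hz : z ∈ triangle τ) (hw : w ∈ triangle τ) :
    (1 - τ ^ 2) / 4 ≤ dist (sim τ j z) (sim τ l w) := by
  rw [dist_comm, dist_eq_norm]
  refine le_trans ?_ (Complex.re_le_norm _)
  have hq : 0 < 1 - τ ^ 2 := by nlinarith
  obtain ⟨a1, a2, a3, a4, a5⟩ := hz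
  obtain ⟨b1, b2, b3, b4, b5⟩ := hw
  obtain ⟨rfl, rfl⟩ | ⟨rfl, rfl⟩ | ⟨rfl, rfl⟩ :
      (j = 0 ∧ l = 2) ∨ (j = 1 ∧ l = 3) ∨ (j = 0 ∧ l = 3) := by
    fin_cases j <;> fin_cases l <;> simp at hjl ⊢
  · simp [sim]; nlinarith
  · simp [sim]; nlinarith
  · simp [sim]; nlinarith

lemma dist_sim_first_last {z w : ℂ}
    (hz : z ∈ triangle τ) (hw : w ∈ triangle τ) :
    (1 - τ ^ 2) / 2 ≤ dist (sim τ 0 z) (sim τ 3 w) := by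
  rw [dist_comm, dist_eq_norm]
  refine le_trans ?_ (Complex.re_le_norm _)
  obtain ⟨a1, a2, a3, a4, a5⟩ := hz
  obtain ⟨b1, b2, b3, b4, b5⟩ := hw
  simp [sim]; nlinarith

/-- The path is routed through both ends of the middle copy and compared with horizontal extents.
The gap (1 - τ²)/4 = 1/c, multiplied by c, pays for the middle copy, whose part is at most 2(1 +
τ²)/4 ≤ 1. -/
lemma dist_add_dist_zero_two (h0 : 0 ≤ τ) (h1 : τ < 1) {c : ℝ} (hc : 4 ≤ c)
    (hcτ : c * (1 - τ ^ 2) = 4) {z y w : ℂ} (hz : z ∈ triangle τ) (hy : y ∈ triangle τ)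
    (hw : w ∈ triangle τ) :
    dist (sim τ 0 z) (sim τ 1 y) + dist (sim τ 1 y) (sim τ 2 w) ≤
      c * dist (sim τ 0 z) (sim τ 2 w) := by
  have hq : 0 < 1 - τ ^ 2 := by nlinarith
  have t1 := dist_triangle (sim τ 0 z) (sim τ 0 1) (sim τ 1 y)
  have t2 := dist_triangle (sim τ 1 y) (sim τ 1 1) (sim τ 2 w)
  rw [dist_sim_one] at t1 t2
  rw [sim_one_eq (l := 1) rfl, dist_zero_sim] at t1
  rw [sim_one_eq (l := 2) rfl, dist_zero_sim] at t2
  have n1 : ‖mirror y‖ ≤ 1 := by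
    rw [← norm_one_sub, ← dist_eq_norm]; exact dist_le_one h0 h1 (one_mem h0) hy
  have n2 : ‖y‖ ≤ 1 := by
    rw [← dist_zero_right]; exact dist_le_one h0 h1 hy (zero_mem h0)
  -- The factor 4 is generous (√2 would do) and is absorbed by c ≥ 4.
  have n3 : ‖mirror z‖ ≤ 4 * (1 - z.re) := by
    obtain ⟨a1, a2, a3, a4, a5⟩ := hz
    apply norm_le_of_sq_le (by linarith)
    simp only [mirror]
    have : z.im ≤ 1 - z.re := by nlinarith
    nlinarith
  have n4 := norm_le_cone h0 h1 hw
  have n5 := Complex.re_le_norm (sim τ 2 w - sim τ 0 z)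
  rw [← dist_eq_norm, dist_comm] at n5
  have e : (sim τ 2 w - sim τ 0 z).re =
      (1 + τ ^ 2) / 4 * (1 - z.re) + (1 - τ ^ 2) / 4 +
        ((1 - τ ^ 2) * w.re + 2 * τ * w.im) / 4 := by
    simp [sim]; ring
  rw [e] at n5
  have hx : 0 ≤ 1 - z.re := by linarith [hz.2.1]
  have ha : 0 ≤ (1 + τ ^ 2) / 4 := by positivity
  have ha' : (1 + τ ^ 2) / 4 ≤ 1 / 2 := by nlinarith
  have m1 : (1 + τ ^ 2) / 4 * ‖mirror z‖ ≤ c * ((1 + τ ^ 2) / 4 * (1 - z.re)) := by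
    calc _ ≤ (1 + τ ^ 2) / 4 * (4 * (1 - z.re)) := by gcongr
      _ = 4 * ((1 + τ ^ 2) / 4 * (1 - z.re)) := by ring
      _ ≤ _ := by gcongr
  have m2 : (1 + τ ^ 2) / 4 * ‖w‖ ≤ c * (((1 - τ ^ 2) * w.re + 2 * τ * w.im) / 4) := by
    calc _ ≤ 1 * ‖w‖ := by gcongr; linarith
      _ = c * ((1 - τ ^ 2) * ‖w‖ / 4) := by linear_combination (-‖w‖ / 4) * hcτ
      _ ≤ _ := by gcongr
  have m3 := mul_le_mul_of_nonneg_left n5 (by linarith : 0 ≤ c)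
  nlinarith

/-- The bound for triples whose first and last points lie in copies that are not adjacent. -/
lemma dist_add_dist_gap (h0 : 0 ≤ τ) (h1 : τ < 1) {c : ℝ} (hc : 4 ≤ c)
    (hcτ : c * (1 - τ ^ 2) = 4) {j i l : Fin 4} (hjl : (j : ℕ) + 1 < l) (hji : j ≤ i) (hil : i ≤ l)
    {z y w : ℂ} (hz : z ∈ triangle τ) (hy : y ∈ triangle τ) (hw : w ∈ triangle τ) :
    dist (sim τ j z) (sim τ i y) + dist (sim τ i y) (sim τ l w) ≤
      c * dist (sim τ j z) (sim τ l w) := by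
  have hgap := mul_le_mul_of_nonneg_left (dist_sim_gap h0 h1 hjl hz hw) (by linarith : 0 ≤ c - 1)
  -- By c(1 - τ²) = 4, the gap bound makes this 2(1 + τ²) ≤ 3 + τ².
  have hside : ∀ i : Fin 4, ∀ u ∈ triangle τ, ∀ v ∈ triangle τ,
      2 * dist (sim τ i u) (sim τ i v) ≤ (c - 1) * dist (sim τ j z) (sim τ l w) := by
    intro i u hu v hv
    refine le_trans ?_ hgap
    rw [dist_sim]
    have := dist_le_one h0 h1 hu hv
    nlinarith
  rcases eq_or_ne j i with rfl | hji'
  · have := hside j z hz y hy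
    have := dist_triangle_left (sim τ j y) (sim τ l w) (sim τ j z)
    linarith [dist_comm (sim τ j y) (sim τ j z)]
  rcases eq_or_ne i l with rfl | hil'
  · have := hside i y hy w hw
    have := dist_triangle_right (sim τ j z) (sim τ i y) (sim τ i w)
    linarith
  obtain ⟨rfl, rfl, rfl⟩ | ⟨rfl, rfl, rfl⟩ | ⟨rfl, rfl⟩ :
      (j = 0 ∧ i = 1 ∧ l = 2) ∨ (j = 1 ∧ i = 2 ∧ l = 3) ∨ (j = 0 ∧ l = 3) := by
    omega
  · exact dist_add_dist_zero_two h0 h1 hc hcτ hz hy hw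
  · have := dist_add_dist_zero_two h0 h1 hc hcτ (mirror_mem hw) (mirror_mem hy) (mirror_mem hz)
    rw [← dist_mirror (sim τ 1 z), ← dist_mirror (sim τ 2 y), ← dist_mirror (sim τ 1 z)]
    simp only [mirror_sim]
    change dist (sim τ 2 _) (sim τ 1 _) + dist (sim τ 1 _) (sim τ 0 _) ≤
      c * dist (sim τ 2 _) (sim τ 0 _)
    rw [dist_comm (sim τ 2 (mirror z)) (sim τ 0 _), dist_comm (sim τ 1 _), dist_comm (sim τ 2 _)]
    linarith
  · have e1 := dist_le_one h0 h1 (sim_mem h0 h1 0 hz) (sim_mem h0 h1 i hy)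
    have e2 := dist_le_one h0 h1 (sim_mem h0 h1 i hy) (sim_mem h0 h1 3 hw)
    have := mul_le_mul_of_nonneg_left (dist_sim_first_last hz hw) (by linarith : 0 ≤ c)
    linarith

/-! ### Farthest points. -/

/-- The two bounds on p say that p is no closer to 1 than to 0 and to the apex, respectively;
convexity of the ball does the rest. -/
lemma dist_le_dist_one_of_re_le (h0 : 0 ≤ τ) {p w : ℂ} (hp : p.re ≤ 1 / 2)
    (hp' : p.re - τ * p.im ≤ (3 - τ ^ 2) / 4) (hw : w ∈ triangle τ) : dist p w ≤ dist p 1 := by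
  have key : triangle τ ⊆ Metric.closedBall p (dist p 1) := by
    refine triangle_subset_of_convex h0 (convex_closedBall _ _) ?_ ?_ ?_ <;>
      rw [Metric.mem_closedBall, dist_comm] <;> apply dist_le_dist_of_sq_le <;>
      simp <;> nlinarith
  rw [dist_comm]
  exact Metric.mem_closedBall.1 (key hw)

/-- From a point of the first two copies, the far end of the base is a farthest point. -/
lemma dist_le_dist_one_of_left (h0 : 0 ≤ τ) (h1 : τ < 1) {j : Fin 4} (hj : j ≤ 1) {z w : ℂ}
    (hz : z ∈ triangle τ) (hw : w ∈ triangle τ) :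
    dist (sim τ j z) w ≤ dist (sim τ j z) 1 := by
  obtain ⟨a1, a2, a3, a4, a5⟩ := hz
  have hq : 0 < 1 - τ ^ 2 := by nlinarith
  have hy : 0 ≤ τ * z.im := mul_nonneg h0 a3
  have hx : (1 - τ ^ 2) * z.re ≤ 1 - τ ^ 2 := by nlinarith
  have hx' : (1 + τ ^ 2) * z.re ≤ 1 + τ ^ 2 := by nlinarith
  have hx'' : 0 ≤ τ ^ 2 * z.re := by positivity
  have hy' : 0 ≤ (1 - τ ^ 2) * (τ * z.im) := by positivity
  have hy'' : 0 ≤ τ ^ 2 * (τ * z.im) := by positivity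
  obtain rfl | rfl : j = 0 ∨ j = 1 := by omega
  all_goals
    refine dist_le_dist_one_of_re_le h0 ?_ ?_ hw <;> simp [sim] <;> linarith

/-- From a point of the third copy, the far end of the base is a farthest point of the fourth. -/
lemma dist_sim_two_three_le (h0 : 0 ≤ τ) (h1 : τ < 1) {z w : ℂ}
    (hz : z ∈ triangle τ) (hw : w ∈ triangle τ) :
    dist (sim τ 2 z) (sim τ 3 w) ≤ dist (sim τ 2 z) 1 := by
  have hq : 0 < 1 - τ ^ 2 := by nlinarith
  -- (7 - τ²)/8 is the midpoint of the base of the fourth copy.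
  have hre : (sim τ 2 z).re ≤ (7 - τ ^ 2) / 8 := by
    obtain ⟨a1, a2, a3, a4, a5⟩ := hz
    simp [sim]
    rcases le_total z.re (1 / 2) with h | h <;> nlinarith
  have hlin : (sim τ 2 z).re - τ * (sim τ 2 z).im ≤ (3 - τ ^ 2) / 4 := by
    obtain ⟨a1, a2, a3, a4, a5⟩ := hz
    have h : z.re + τ * z.im ≤ 1 := by nlinarith
    have := mul_le_mul_of_nonneg_left h (by positivity : 0 ≤ 1 + τ ^ 2)
    simp [sim]
    linarith
  generalize sim τ 2 z = p at hre hlin ⊢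
  have key : triangle τ ⊆ sim τ 3 ⁻¹' Metric.closedBall p (dist p 1) := by
    refine triangle_subset_of_convex h0 (convex_preimage_sim (convex_closedBall _ _) 3) ?_ ?_ ?_ <;>
      rw [Set.mem_preimage, Metric.mem_closedBall, dist_comm] <;> apply dist_le_dist_of_sq_le <;>
      simp [sim] <;> ring_nf
    · nlinarith
    -- The fourth copy is homothetic to the triangle from 1, so the bisector between its apex and 1
    -- is parallel to that of `hlin` and nearer to 1.
    · have ha : 0 ≤ (1 + τ ^ 2) / 4 := by positivity
      have ha' : 0 ≤ 1 - (1 + τ ^ 2) / 4 := by linarith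
      linarith [mul_nonneg ha (sub_nonneg.2 hlin), mul_nonneg (mul_nonneg ha ha) ha']
    · rfl
  rw [dist_comm]
  exact Metric.mem_closedBall.1 (key hw)

/-- From a point of the third copy, the far end of the base is at least as far away as the end of
the copy. -/
lemma dist_sim_two_one_le (h0 : 0 ≤ τ) (h1 : τ < 1) {z : ℂ} (hz : z ∈ triangle τ) :
    dist (sim τ 2 z) (sim τ 2 1) ≤ dist (sim τ 2 z) 1 := by
  rw [sim_one_eq (l := 3) rfl]
  exact dist_sim_two_three_le h0 h1 hz (zero_mem h0)

/-! ### The slope parameter and self-similarity of the generations. -/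

lemma slope_nonneg (c : ℝ) : 0 ≤ slope c := Real.sqrt_nonneg _

lemma slope_sq (hc : 4 ≤ c) : slope c ^ 2 = 1 - 4 / c := by
  rw [slope, Real.sq_sqrt]
  rw [sub_nonneg, div_le_one (by linarith)]
  exact hc

lemma mul_one_sub_slope_sq (hc : 4 ≤ c) : c * (1 - slope c ^ 2) = 4 := by
  have : c ≠ 0 := by positivity
  rw [slope_sq hc]
  field_simp
  ring

lemma slope_lt_one (hc : 4 ≤ c) : slope c < 1 := by
  have h : 0 < 4 / c := by positivity
  nlinarith [slope_nonneg c, slope_sq hc]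

lemma pattern_eq_base (hc : 4 ≤ c) : pattern c = base (slope c) := by
  have h0 : c ≠ 0 := by positivity
  have h2 : c - 2 ≠ 0 := by linarith
  have e1 : sideLength c / cStar c = 1 / c := by
    have h3 : cStar c ≠ 0 := by rw [cStar]; positivity
    have h4 : cStar c + 1 = c / 2 := by rw [cStar]; ring
    rw [sideLength, h4]
    field_simp
  have e2 : sideLength c * √(cStar c ^ 2 - 1) / cStar c = slope c / 2 := by
    have : √(cStar c ^ 2 - 1) = c / 2 * slope c := by
      have : cStar c ^ 2 - 1 = (c / 2 * slope c) ^ 2 := by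
        rw [mul_pow, slope_sq hc, cStar]
        field_simp
        ring
      rw [this, Real.sqrt_sq (mul_nonneg (by positivity) (slope_nonneg c))]
    rw [mul_div_right_comm, e1, this]
    field_simp
  funext j
  rw [pattern, e1, e2]
  fin_cases j <;> apply Complex.ext <;> simp [slope_sq hc] <;> field_simp <;> ring

lemma vertex_one_of_le {i : ℕ} (hc : 4 ≤ c) {j : Fin 4} (hi : i ≤ 1) :
    cesaroVertex c 1 (j + i) = sim (slope c) j i := by
  simp only [cesaroVertex, pattern_eq_base hc]
  interval_cases i <;> fin_cases j <;>
    simp [sim, Fin.ofNat] <;> apply Complex.ext <;> simp <;> ring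

lemma vertex_step (c : ℝ) (k i : ℕ) : cesaroVertex c (k + 1) i =
    cesaroVertex c k (i / 4) +
      pattern c (Fin.ofNat 4 i) * (cesaroVertex c k (i / 4 + 1) - cesaroVertex c k (i / 4)) :=
  rfl

/-- Each of the four consecutive parts of a generation is a similar copy of the previous
generation. -/
lemma vertex_succ (hc : 4 ≤ c) (k : ℕ) (j : Fin 4) {i : ℕ} (hi : i ≤ 4 ^ k) :
    cesaroVertex c (k + 1) (j * 4 ^ k + i) = sim (slope c) j (cesaroVertex c k i) := by
  induction k generalizing i with
  | zero => simpa [cesaroVertex] using vertex_one_of_le hc hi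
  | succ k ih =>
    have hpow : (j : ℕ) * 4 ^ (k + 1) = 4 * (j * 4 ^ k) := by ring
    have hdiv : (j * 4 ^ (k + 1) + i) / 4 = j * 4 ^ k + i / 4 := by omega
    have hmod : Fin.ofNat 4 (j * 4 ^ (k + 1) + i) = Fin.ofNat 4 i := by
      apply Fin.ext
      simp only [Fin.ofNat]
      omega
    have hi' : i / 4 ≤ 4 ^ k := by omega
    rw [vertex_step c (k + 1), hdiv, hmod, vertex_step c k i, ih hi']
    -- At the last index the recursion refers to a vertex past the end, outside the reach of `ih`;
    -- its pattern coefficient is 0.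
    rcases hi.eq_or_lt with rfl | hlt
    · have h : Fin.ofNat 4 (4 ^ (k + 1)) = 0 := by
        apply Fin.ext
        simp only [Fin.ofNat]
        omega
      have hp : pattern c (Fin.ofNat 4 (4 ^ (k + 1))) = 0 := by rw [h]; rfl
      rw [hp]
      simp
    · rw [add_assoc, ih (by omega : i / 4 + 1 ≤ 4 ^ k)]
      simp only [sim]
      ring

/-- A vertex shared by two blocks is assigned to the later one; only the very last vertex ends its
block. This makes the block number monotone (`block_le`). -/
lemma exists_block (k : ℕ) {i : ℕ} (hi : i ≤ 4 ^ (k + 1)) :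
    ∃ (j : Fin 4) (i' : ℕ), i' ≤ 4 ^ k ∧ i = j * 4 ^ k + i' ∧ (i' = 4 ^ k → j = 3) := by
  rcases hi.eq_or_lt with rfl | hlt
  · exact ⟨3, 4 ^ k, le_rfl, by simp; ring, fun _ => rfl⟩
  · have hpos : 0 < 4 ^ k := by positivity
    refine ⟨⟨i / 4 ^ k, ?_⟩, i % 4 ^ k, (Nat.mod_lt _ hpos).le, ?_, fun h => ?_⟩
    · rw [Nat.div_lt_iff_lt_mul hpos]
      linarith [pow_succ 4 k]
    · simp only
      rw [mul_comm, Nat.div_add_mod]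
    · exact absurd h (Nat.mod_lt _ hpos).ne

lemma exists_block_lt (k : ℕ) {i : ℕ} (hi : i < 4 ^ (k + 1)) :
    ∃ (j : Fin 4) (i' : ℕ), i' < 4 ^ k ∧ i = j * 4 ^ k + i' := by
  obtain ⟨j, i', hi', rfl, hj⟩ := exists_block k hi.le
  refine ⟨j, i', lt_of_le_of_ne hi' fun h => ?_, rfl⟩
  rw [hj h, h] at hi
  simp at hi
  omega

lemma block_le {N i l i' l' : ℕ} {A B : Fin 4} (hN : i ≤ l) (hi' : i = A * N + i')
    (hl' : l = B * N + l') (hle : l' ≤ N) (hB : l' = N → B = 3) : A ≤ B := by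
  by_contra! hlt
  have h1 : ((B : ℕ) + 1) * N ≤ A * N := Nat.mul_le_mul_right _ hlt
  have h2 : l' ≠ N := fun h => by
    have := hB h
    omega
  have : l' < N := lt_of_le_of_ne hle h2
  linarith

lemma vertex_mem (hc : 4 ≤ c) (k : ℕ) {i : ℕ} (hi : i ≤ 4 ^ k) :
    cesaroVertex c k i ∈ triangle (slope c) := by
  induction k generalizing i with
  | zero =>
    have h : i ≤ 1 := by simpa using hi
    interval_cases i
    · simpa [cesaroVertex] using zero_mem (slope_nonneg c)
    · simpa [cesaroVertex] using one_mem (slope_nonneg c)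
  | succ k ih =>
    obtain ⟨j, i', hi', rfl, -⟩ := exists_block k hi
    rw [vertex_succ hc k j hi']
    exact sim_mem (slope_nonneg c) (slope_lt_one hc) j (ih hi')

lemma vertex_zero (c : ℝ) (k : ℕ) : cesaroVertex c k 0 = 0 := by
  induction k with
  | zero => simp [cesaroVertex]
  | succ k ih => simp [cesaroVertex, ih, pattern, Fin.ofNat]

lemma vertex_last (c : ℝ) (k : ℕ) : cesaroVertex c k (4 ^ k) = 1 := by
  induction k with
  | zero => simp [cesaroVertex]
  | succ k ih =>
    have h1 : 4 ^ (k + 1) / 4 = 4 ^ k := by omega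
    have h2 : Fin.ofNat 4 (4 ^ (k + 1)) = 0 := by
      apply Fin.ext
      simp only [Fin.ofNat]
      omega
    rw [vertex_step, h1, h2, ih]
    simp [pattern]

lemma vertex_mirror (hc : 4 ≤ c) (k : ℕ) {i l : ℕ} (hil : i + l = 4 ^ k) :
    cesaroVertex c k l = mirror (cesaroVertex c k i) := by
  induction k generalizing i l with
  | zero =>
    have h : i ≤ 1 := by simp at hil; omega
    interval_cases i
    · obtain rfl : l = 1 := by simpa using hil
      simp [cesaroVertex, mirror_zero]
    · obtain rfl : l = 0 := by simpa using hil
      simp [cesaroVertex, mirror_one]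
  | succ k ih =>
    obtain ⟨j, i', hi', rfl, -⟩ := exists_block k (i := i) (by omega)
    obtain ⟨l', hl'⟩ := Nat.exists_eq_add_of_le hi'
    have hl : l = (j.rev : ℕ) * 4 ^ k + l' := by
      fin_cases j <;> simp [Fin.rev] at hil ⊢ <;> omega
    rw [hl, vertex_succ hc k _ hi', vertex_succ hc k _ (by omega), mirror_sim, ih hl'.symm]

lemma dist_vertex_succ (hc : 4 ≤ c) (k : ℕ) {i : ℕ} (hi : i < 4 ^ k) :
    dist (cesaroVertex c k i) (cesaroVertex c k (i + 1)) = ((1 + slope c ^ 2) / 4) ^ k := by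
  induction k generalizing i with
  | zero =>
    obtain rfl : i = 0 := by simpa using hi
    simp [cesaroVertex]
  | succ k ih =>
    obtain ⟨j, i', hlt, rfl⟩ := exists_block_lt k hi
    rw [add_assoc, vertex_succ hc k j hlt.le, vertex_succ hc k j hlt, dist_sim, ih hlt,
      pow_succ' ((1 + slope c ^ 2) / 4)]

/-! ### The c-chain property and distinct vertices. -/

/-- The last vertex is a farthest one among those that follow a given vertex. -/
lemma dist_le_dist_last (hc : 4 ≤ c) (k : ℕ) {i l : ℕ} (hil : i ≤ l) (hl : l ≤ 4 ^ k) :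
    dist (cesaroVertex c k i) (cesaroVertex c k l) ≤ dist (cesaroVertex c k i) 1 := by
  have h0 := slope_nonneg c
  have h1 := slope_lt_one hc
  induction k generalizing i l with
  | zero =>
    have h : l ≤ 1 := by simpa using hl
    interval_cases l
    · obtain rfl : i = 0 := by omega
      simp
    · simp [cesaroVertex]
  | succ k ih =>
    obtain ⟨A, i', hi', hiA, hA⟩ := exists_block k (hil.trans hl)
    obtain ⟨B, l', hl', hlB, hB⟩ := exists_block k hl
    have hAB := block_le hil hiA hlB hl' hB
    have hi'T := vertex_mem hc k hi'
    have hl'T := vertex_mem hc k hl'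
    have hsame : A = B → dist (sim (slope c) A (cesaroVertex c k i'))
        (sim (slope c) B (cesaroVertex c k l')) ≤
          dist (sim (slope c) A (cesaroVertex c k i')) (sim (slope c) A 1) := by
      rintro rfl
      rw [dist_sim, dist_sim]
      have := ih (i := i') (l := l') (by omega) hl'
      gcongr
    rw [hiA, hlB, vertex_succ hc k A hi', vertex_succ hc k B hl']
    obtain h | ⟨rfl, rfl⟩ | ⟨rfl, rfl⟩ | ⟨rfl, rfl⟩ :
        A ≤ 1 ∨ (A = 2 ∧ B = 2) ∨ (A = 2 ∧ B = 3) ∨ (A = 3 ∧ B = 3) := by omega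
    · exact dist_le_dist_one_of_left h0 h1 h hi'T (sim_mem h0 h1 B hl'T)
    · exact (hsame rfl).trans (dist_sim_two_one_le h0 h1 hi'T)
    · exact dist_sim_two_three_le h0 h1 hi'T hl'T
    · exact (hsame rfl).trans_eq (by rw [sim_three_one])

/-- The first vertex is a farthest one among those that precede a given vertex. -/
lemma dist_le_dist_first (hc : 4 ≤ c) (k : ℕ) {i l : ℕ} (hil : i ≤ l) (hl : l ≤ 4 ^ k) :
    dist (cesaroVertex c k i) (cesaroVertex c k l) ≤ dist 0 (cesaroVertex c k l) := by
  have h := dist_le_dist_last hc k (i := 4 ^ k - l) (l := 4 ^ k - i) (by omega) (by omega)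
  rw [vertex_mirror hc k (i := i) (l := 4 ^ k - i) (by omega),
    vertex_mirror hc k (i := l) (l := 4 ^ k - l) (by omega),
    ← mirror_zero, dist_mirror, dist_mirror, dist_comm] at h
  rwa [dist_comm 0]

/-- The `c`-chain inequality for three vertices of a generation. -/
lemma dist_add_dist_le (hc : 4 ≤ c) (k : ℕ) {i j l : ℕ} (hij : i ≤ j) (hjl : j ≤ l)
    (hl : l ≤ 4 ^ k) :
    dist (cesaroVertex c k i) (cesaroVertex c k j) +
      dist (cesaroVertex c k j) (cesaroVertex c k l) ≤
        c * dist (cesaroVertex c k i) (cesaroVertex c k l) := by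
  have h0 := slope_nonneg c
  have h1 := slope_lt_one hc
  have hcτ := mul_one_sub_slope_sq hc
  induction k generalizing i j l with
  | zero =>
    have hc1 : 1 ≤ c := by linarith
    have h : l ≤ 1 := by simpa using hl
    interval_cases l
    · obtain rfl : j = 0 := by omega
      obtain rfl : i = 0 := by omega
      simp
    · interval_cases j
      · obtain rfl : i = 0 := by omega
        simp [cesaroVertex, hc1]
      · interval_cases i <;> simp [cesaroVertex, hc1]
  | succ k ih =>
    obtain ⟨A, i', hi', hiA, hA⟩ := exists_block k ((hij.trans hjl).trans hl)
    obtain ⟨B, j', hj', hjB, hB⟩ := exists_block k (hjl.trans hl)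
    obtain ⟨C, l', hl', hlC, hC⟩ := exists_block k hl
    have hAB := block_le hij hiA hjB hj' hB
    have hBC := block_le hjl hjB hlC hl' hC
    have hiT := vertex_mem hc k hi'
    have hjT := vertex_mem hc k hj'
    have hlT := vertex_mem hc k hl'
    rw [hiA, hjB, hlC, vertex_succ hc k A hi', vertex_succ hc k B hj', vertex_succ hc k C hl']
    rcases lt_or_ge ((A : ℕ) + 1) C with hgap | hgap
    · exact dist_add_dist_gap h0 h1 hc hcτ hgap hAB hBC hiT hjT hlT
    rcases eq_or_ne A C with rfl | hne
    · obtain rfl : A = B := le_antisymm hAB hBC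
      have := ih (i := i') (j := j') (l := l') (by omega) (by omega) hl'
      rw [dist_sim, dist_sim, dist_sim, ← mul_add, mul_left_comm]
      gcongr
    have hadj : (C : ℕ) = A + 1 := by omega
    have key := dist_sim_adjacent h0 h1 hadj hiT hlT
    have hq : 0 < 1 - slope c ^ 2 := by nlinarith
    -- the distance of `i` and `l` dominates those to the common vertex of the two blocks
    have hfar : 2 * (dist (sim (slope c) A (cesaroVertex c k i')) (sim (slope c) A 1) +
        dist (sim (slope c) C 0) (sim (slope c) C (cesaroVertex c k l'))) ≤
        (c - 1) * dist (sim (slope c) A (cesaroVertex c k i'))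
          (sim (slope c) C (cesaroVertex c k l')) := by
      set D := dist (sim (slope c) A (cesaroVertex c k i'))
          (sim (slope c) C (cesaroVertex c k l')) with hD
      have hD0 : 0 ≤ D := dist_nonneg
      -- After this scaling, `key` leaves 2(1 + τ²) ≤ 3 + τ².
      rw [← mul_le_mul_iff_right₀ hq]
      have : (1 - slope c ^ 2) * ((c - 1) * D) = (3 + slope c ^ 2) * D := by
        linear_combination D * hcτ
      rw [this]
      nlinarith
    obtain rfl | rfl : B = A ∨ B = C := by omega
    · have hM := dist_le_dist_last hc k (i := i') (l := j') (by omega) hj'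
      have hM' : dist (sim (slope c) B (cesaroVertex c k i')) (sim (slope c) B
          (cesaroVertex c k j')) ≤
          dist (sim (slope c) B (cesaroVertex c k i')) (sim (slope c) B 1) := by
        rw [dist_sim, dist_sim]; gcongr
      have t := dist_triangle_left (sim (slope c) B (cesaroVertex c k j'))
        (sim (slope c) C (cesaroVertex c k l')) (sim (slope c) B (cesaroVertex c k i'))
      have : 0 ≤ dist (sim (slope c) C 0) (sim (slope c) C (cesaroVertex c k l')) := dist_nonneg
      linarith
    · have hM := dist_le_dist_first hc k (i := j') (l := l') (by omega) hl'
      have hM' : dist (sim (slope c) B (cesaroVertex c k j')) (sim (slope c) B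
          (cesaroVertex c k l')) ≤
          dist (sim (slope c) B 0) (sim (slope c) B (cesaroVertex c k l')) := by
        rw [dist_sim, dist_sim]; gcongr
      have t := dist_triangle_right (sim (slope c) A (cesaroVertex c k i'))
        (sim (slope c) B (cesaroVertex c k j')) (sim (slope c) B (cesaroVertex c k l'))
      have : 0 ≤ dist (sim (slope c) A (cesaroVertex c k i')) (sim (slope c) A 1) := dist_nonneg
      linarith

/-- Were the two vertices equal, the c-chain inequality would bound a positive edge length by 0. -/
lemma vertex_ne (hc : 4 ≤ c) (k : ℕ) {i l : ℕ} (hil : i < l) (hl : l ≤ 4 ^ k) :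
    cesaroVertex c k i ≠ cesaroVertex c k l := by
  intro h
  have key := dist_add_dist_le hc k (i := i) (j := i + 1) (l := l) (by omega) hil hl
  rw [h, dist_self, ← h, dist_vertex_succ hc k (by omega)] at key
  have h1 : 0 < ((1 + slope c ^ 2) / 4) ^ k := by positivity
  have h2 : 0 ≤ dist (cesaroVertex c k (i + 1)) (cesaroVertex c k i) := dist_nonneg
  linarith

/-! ### Simplicity. -/

lemma sim_image_segment (j : Fin 4) (u v : ℂ) :
    sim τ j '' segment ℝ u v = segment ℝ (sim τ j u) (sim τ j v) := by
  rw [segment_eq_image, segment_eq_image, Set.image_image]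
  refine Set.image_congr fun t _ => ?_
  simp only [sim, Complex.real_smul]
  push_cast
  ring

/-- Copies of the triangle meet only in the common vertex of adjacent copies. -/
lemma eq_of_sim_eq (h0 : 0 ≤ τ) (h1 : τ < 1) {j l : Fin 4} (hjl : j < l) {z w : ℂ}
    (hz : z ∈ triangle τ) (hw : w ∈ triangle τ) (h : sim τ j z = sim τ l w) :
    (l : ℕ) = j + 1 ∧ z = 1 ∧ w = 0 := by
  have hq : 0 < 1 - τ ^ 2 := by nlinarith
  have hjl' : (l : ℕ) = j + 1 := by
    by_contra hne
    have hgap := dist_sim_gap h0 h1 (j := j) (l := l) (by omega) hz hw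
    rw [h, dist_self] at hgap
    linarith
  have hadj := dist_sim_adjacent h0 h1 hjl' hz hw
  rw [← h, dist_self, mul_zero] at hadj
  have p1 : 0 ≤ dist (sim τ j z) (sim τ j 1) := dist_nonneg
  have p2 : 0 ≤ dist (sim τ l 0) (sim τ j z) := dist_nonneg
  have e1 : dist (sim τ j z) (sim τ j 1) = 0 := by nlinarith
  have e2 : dist (sim τ l 0) (sim τ j z) = 0 := by nlinarith
  rw [h, dist_eq_zero] at e2
  exact ⟨hjl', sim_injective j (dist_eq_zero.1 e1), (sim_injective l e2).symm⟩

/-- The `i`-th segment of generation `k`. -/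
noncomputable def segmentAt (c : ℝ) (k i : ℕ) : Set ℂ :=
  segment ℝ (cesaroVertex c k i) (cesaroVertex c k (i + 1))

lemma segmentAt_subset (hc : 4 ≤ c) (k : ℕ) {i : ℕ} (hi : i < 4 ^ k) :
    segmentAt c k i ⊆ triangle (slope c) :=
  convex_triangle.segment_subset (vertex_mem hc k hi.le) (vertex_mem hc k hi)

lemma segmentAt_succ (hc : 4 ≤ c) (k : ℕ) (j : Fin 4) {i : ℕ} (hi : i < 4 ^ k) :
    segmentAt c (k + 1) (j * 4 ^ k + i) = sim (slope c) j '' segmentAt c k i := by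
  rw [segmentAt, segmentAt, sim_image_segment, add_assoc, vertex_succ hc k j hi.le,
    vertex_succ hc k j hi]

/-- With its counterpart for 1, this shows that only the last segment of one copy and the first of
the next reach their common vertex. -/
lemma eq_zero_of_zero_mem_segmentAt (hc : 4 ≤ c) (k : ℕ) {i : ℕ} (hi : i < 4 ^ k)
    (h : (0 : ℂ) ∈ segmentAt c k i) : i = 0 := by
  induction k generalizing i with
  | zero => simpa using hi
  | succ k ih =>
    obtain ⟨j, i', hi', rfl⟩ := exists_block_lt k hi
    rw [segmentAt_succ hc k j hi'] at h
    obtain ⟨z, hz, hz0⟩ := h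
    rw [← sim_zero_zero (τ := slope c)] at hz0
    rcases eq_or_ne j 0 with rfl | hj
    · rw [sim_injective 0 hz0] at hz
      simp [ih hi' hz]
    · have := (eq_of_sim_eq (slope_nonneg c) (slope_lt_one hc) (Fin.pos_of_ne_zero hj)
        (zero_mem (slope_nonneg c)) (segmentAt_subset hc k hi' hz) hz0.symm).2.1
      exact absurd this zero_ne_one

lemma eq_last_of_one_mem_segmentAt (hc : 4 ≤ c) (k : ℕ) {i : ℕ} (hi : i < 4 ^ k)
    (h : (1 : ℂ) ∈ segmentAt c k i) : i + 1 = 4 ^ k := by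
  induction k generalizing i with
  | zero => simpa using hi
  | succ k ih =>
    obtain ⟨j, i', hi', rfl⟩ := exists_block_lt k hi
    rw [segmentAt_succ hc k j hi'] at h
    obtain ⟨z, hz, hz1⟩ := h
    rw [← sim_three_one (τ := slope c)] at hz1
    rcases eq_or_ne j 3 with rfl | hj
    · rw [sim_injective 3 hz1] at hz
      have := ih hi' hz
      simp only [Fin.coe_ofNat_eq_mod]
      omega
    · have := (eq_of_sim_eq (slope_nonneg c) (slope_lt_one hc) (by omega : j < 3)
        (segmentAt_subset hc k hi' hz) (one_mem (slope_nonneg c)) hz1).2.2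
      exact absurd this one_ne_zero

/-- Two segments of a generation meet only if they are consecutive, and then in their common
endpoint. -/
lemma eq_of_mem_segmentAt (hc : 4 ≤ c) (k : ℕ) {i l : ℕ} (hil : i < l) (hl : l < 4 ^ k) {x : ℂ}
    (hxi : x ∈ segmentAt c k i) (hxl : x ∈ segmentAt c k l) :
    l = i + 1 ∧ x = cesaroVertex c k l := by
  induction k generalizing i l x with
  | zero => simp at hl; omega
  | succ k ih =>
    obtain ⟨A, i', hi', hiA⟩ := exists_block_lt k (hil.trans hl)
    obtain ⟨B, l', hl', hlB⟩ := exists_block_lt k hl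
    have hAB : A ≤ B := block_le hil.le hiA hlB hl'.le fun h => absurd h hl'.ne
    rw [hiA, segmentAt_succ hc k A hi'] at hxi
    rw [hlB, segmentAt_succ hc k B hl'] at hxl
    obtain ⟨z, hz, rfl⟩ := hxi
    obtain ⟨w, hw, hwz⟩ := hxl
    rw [hlB, vertex_succ hc k B hl'.le]
    rcases hAB.eq_or_lt with rfl | hlt
    · obtain rfl := sim_injective A hwz
      obtain ⟨h1, h2⟩ := ih (by omega) hl' hz hw
      exact ⟨by omega, by rw [h2]⟩
    · obtain ⟨hadj, rfl, rfl⟩ := eq_of_sim_eq (slope_nonneg c) (slope_lt_one hc) hlt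
        (segmentAt_subset hc k hi' hz) (segmentAt_subset hc k hl' hw) hwz.symm
      have e1 := eq_last_of_one_mem_segmentAt hc k hi' hz
      obtain rfl := eq_zero_of_zero_mem_segmentAt hc k hl' hw
      refine ⟨?_, by rw [vertex_zero, hwz]⟩
      rw [hiA, hadj, add_assoc, e1]
      ring

theorem isSimple_cesaroChain (hc : 4 ≤ c) (k : ℕ) : (cesaroChain c k).IsSimple := by
  intro i l hil
  have key : ∀ x, x ∈ (cesaroChain c k).seg i → x ∈ (cesaroChain c k).seg l →
      (l : ℕ) = i + 1 ∧ x = cesaroVertex c k l :=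
    fun x h1 h2 => eq_of_mem_segmentAt hc k hil l.2 h1 h2
  constructor
  · intro h
    refine Set.Subset.antisymm (fun x hx => (key x hx.1 hx.2).2) ?_
    rintro _ rfl
    refine ⟨?_, left_mem_segment _ _ _⟩
    have : l.castSucc = i.succ := Fin.ext h
    rw [this]
    exact right_mem_segment _ _ _
  · intro h
    rw [Set.eq_empty_iff_forall_notMem]
    exact fun x hx => h (key x hx.1 hx.2).1

theorem isCChain_cesaroChain (hc : 4 ≤ c) (k : ℕ) : (cesaroChain c k).IsCChain c :=
  fun _ _ l hij hjl => dist_add_dist_le hc k (le_of_lt hij) (le_of_lt hjl) (Nat.le_of_lt_succ l.2)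

theorem ncard_range_cesaroChain (hc : 4 ≤ c) (k : ℕ) :
    (Set.range (cesaroChain c k)).ncard = 4 ^ k + 1 := by
  have hinj : Function.Injective (cesaroChain c k) := by
    intro i l h
    by_contra hne
    rcases lt_or_gt_of_ne hne with hlt | hlt
    · exact vertex_ne hc k hlt (Nat.le_of_lt_succ l.2) h
    · exact vertex_ne hc k hlt (Nat.le_of_lt_succ i.2) h.symm
  rw [← Set.image_univ, Set.ncard_image_of_injective _ hinj, Set.ncard_univ, Nat.card_fin]

/-! ### Stretch factor and its exponent. -/

theorem stretchFactor_cesaroChain (hc : 4 ≤ c) (k : ℕ) :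
    (cesaroChain c k).stretchFactor = (2 * ((c - 2) / c)) ^ k := by
  have hc0 : c ≠ 0 := by positivity
  have hsum : ∀ i : Fin (4 ^ k), dist (cesaroChain c k i.castSucc) (cesaroChain c k i.succ) =
      ((1 + slope c ^ 2) / 4) ^ k := fun i => dist_vertex_succ hc k i.2
  have h0 : cesaroChain c k 0 = 0 := vertex_zero c k
  have h1 : cesaroChain c k (Fin.last _) = 1 := vertex_last c k
  rw [PolygonalChain.stretchFactor, Finset.sum_congr rfl fun i _ => hsum i, h0, h1]
  simp only [Finset.sum_const, Finset.card_univ, Fintype.card_fin, nsmul_eq_mul, dist_zero_left,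
    norm_one, div_one]
  push_cast
  rw [← mul_pow, slope_sq hc]
  congr 1
  field_simp
  ring

lemma four_rpow_stretchExponent (hc : 4 ≤ c) :
    (4 : ℝ) ^ stretchExponent c = 2 * ((c - 2) / c) := by
  have h4 : (4 : ℝ) = 2 ^ (2 : ℝ) := by norm_num
  have he : 2 * stretchExponent c = 1 + Real.logb 2 (c - 2) - Real.logb 2 c := by
    rw [stretchExponent]; ring
  rw [h4, ← Real.rpow_mul (by norm_num), he, Real.rpow_sub (by norm_num),
    Real.rpow_add (by norm_num), Real.rpow_one, Real.rpow_logb (by norm_num) (by norm_num)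
    (by linarith), Real.rpow_logb (by norm_num) (by norm_num) (by linarith), mul_div_assoc]

theorem stretchFactor_eq_rpow (hc : 4 ≤ c) (k : ℕ) :
    (cesaroChain c k).stretchFactor = ((4 : ℝ) ^ k) ^ stretchExponent c := by
  rw [stretchFactor_cesaroChain hc, ← four_rpow_stretchExponent hc, ← Real.rpow_natCast,
    ← Real.rpow_mul (by norm_num), ← Real.rpow_natCast 4, ← Real.rpow_mul (by norm_num), mul_comm]

theorem tendsto_stretchExponent :
    Filter.Tendsto stretchExponent Filter.atTop (nhds (1 / 2)) := by
  have h1 : Filter.Tendsto (fun c : ℝ => 1 - 2 / c) Filter.atTop (nhds 1) := by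
    have h : Filter.Tendsto (fun c : ℝ => 2 / c) Filter.atTop (nhds 0) :=
      tendsto_const_nhds.div_atTop Filter.tendsto_id
    simpa using h.const_sub 1
  have h2 : Filter.Tendsto (fun c : ℝ => (1 + Real.logb 2 (1 - 2 / c)) / 2) Filter.atTop
      (nhds ((1 + Real.logb 2 1) / 2)) :=
    ((h1.logb one_ne_zero).const_add 1).div_const 2
  rw [Real.logb_one, add_zero] at h2
  refine h2.congr' ?_
  filter_upwards [Filter.eventually_gt_atTop 2] with c hc
  have e : 1 - 2 / c = (c - 2) / c := by
    have : c ≠ 0 := by positivity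
    field_simp
  rw [stretchExponent, e, Real.logb_div (by linarith) (by linarith)]
  ring

/-- Passes from n - 1 to n. The exponent 1/2 - ε may be negative; if it is not, x + 1 ≤ 2x gives the
constant. -/
lemma exists_mul_rpow_le (b : ℝ) :
    ∃ κ : ℝ, 0 < κ ∧ ∀ x : ℝ, 1 ≤ x → κ * (x + 1) ^ b ≤ x ^ b := by
  rcases le_total 0 b with hb | hb
  · refine ⟨2⁻¹ ^ b, by positivity, fun x hx => ?_⟩
    rw [← Real.mul_rpow (by norm_num) (by linarith)]
    exact Real.rpow_le_rpow (by linarith) (by linarith) hb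
  · refine ⟨1, one_pos, fun x hx => ?_⟩
    rw [one_mul]
    exact Real.rpow_le_rpow_of_nonpos (by linarith) (by linarith) hb

end Cesaro

theorem theorem4 :
    (∀ c : ℝ, 4 ≤ c → ∀ k n : ℕ, n = 4 ^ k + 1 →
      (Set.range (cesaroChain c k)).ncard = n ∧
      (cesaroChain c k).IsSimple ∧
      (cesaroChain c k).IsCChain c ∧
      (cesaroChain c k).stretchFactor = ((n : ℝ) - 1) ^ stretchExponent c) ∧
    Filter.Tendsto stretchExponent Filter.atTop (nhds (1 / 2)) ∧
    (∀ ε : ℝ, 0 < ε → ∃ c₀ : ℝ, 4 ≤ c₀ ∧ ∃ κ : ℝ, 0 < κ ∧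
      ∀ c : ℝ, c₀ ≤ c → ∀ k n : ℕ, n = 4 ^ k + 1 →
        κ * (n : ℝ) ^ (1 / 2 - ε) ≤ (cesaroChain c k).stretchFactor) := by
  refine ⟨?_, Cesaro.tendsto_stretchExponent, ?_⟩
  · rintro c hc k n rfl
    refine ⟨Cesaro.ncard_range_cesaroChain hc k, Cesaro.isSimple_cesaroChain hc k,
      Cesaro.isCChain_cesaroChain hc k, ?_⟩
    rw [Cesaro.stretchFactor_eq_rpow hc]
    push_cast
    rw [add_sub_cancel_right]
  · intro ε hε
    obtain ⟨c₁, hc₁⟩ := Filter.eventually_atTop.1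
      (Cesaro.tendsto_stretchExponent.eventually_const_le (by linarith : 1 / 2 - ε < 1 / 2))
    obtain ⟨κ, hκ, hle⟩ := Cesaro.exists_mul_rpow_le (1 / 2 - ε)
    refine ⟨max 4 c₁, le_max_left _ _, κ, hκ, ?_⟩
    rintro c hc k n rfl
    have h4 : 4 ≤ c := (le_max_left _ _).trans hc
    have h1 : (1 : ℝ) ≤ 4 ^ k := one_le_pow₀ (by norm_num)
    rw [Cesaro.stretchFactor_eq_rpow h4]
    push_cast
    exact (hle _ h1).trans (Real.rpow_le_rpow_of_exponent_le h1
      (hc₁ c ((le_max_right _ _).trans hc)))
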